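/- Let $\mathcal Z\subseteq\mathbb R^n$ be non-empty and closed, and equip the set $\mathcal P(\mathcal Z)$ of Borel probability measures on $\mathcal Z$ with the topology of weak convergence. Let $c:\mathcal Z\times\mathcal Z\to[0,+\infty]$ be a transportation cost function satisfying $c(z,\hat z)=0$ if and only if $z=\hat z$. For $\mathbb Q,\hat{\mathbb P}\in\mathcal P(\mathcal Z)$ let $\Pi(\mathbb Q,\hat{\mathbb P})$ be the set of all probability measures on $\mathcal Z\times\mathcal Z$ with first marginal $\mathbb Q$ and second marginal $\hat{\mathbb P}$, and set $$d_c(\mathbb Q,\hat{\mathbb P})=\inf_{\pi\in\Pi(\mathbb Q,\hat{\mathbb P})}\mathbb E_{(Z,\hat Z)\sim\pi}[c(Z,\hat Z)],\qquad \mathbb B_\varepsilon(\hat{\mathbb P})=\{\mathbb Q\in\mathcal P(\mathcal Z): d_c(\mathbb Q,\hat{\mathbb P})\le\varepsilon\}.$$ Fix $\hat{\mathbb P}\in\mathcal P(\mathcal Z)$ and assume that 1. $c$ is lower semicontinuous on $\mathcal Z\times\mathcal Z$; 2. there exist a reference point $\hat z_0\in\mathcal Z$ and a constant $C<\infty$ such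 that $\mathbb E_{Z\sim\hat{\mathbb P}}[c(Z,\hat z_0)]\le C$; 3. there exist a metric $d$ on the set $\mathcal Z$ (not necessarily inducing the Euclidean topology) and an exponent $p\in\mathbb N$, $p\ge1$, such that all sublevel sets $\{z\in\mathcal Z: d(z,z_0)\le r\}$, $z_0\in\mathcal Z$, $r\in\mathbb R$, are compact in the Euclidean topology and $c(z,\hat z)\ge d(z,\hat z)^p$ for all $z,\hat z\in\mathcal Z$. Then, for every $\varepsilon\ge0$, the ambiguity set $\mathbb B_\varepsilon(\hat{\mathbb P})$ is weakly compact, that is, compact in $\mathcal P(\mathcal Z)$ with respect to the topology of weak convergence. -/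

import Mathlib

open MeasureTheory
open scoped ENNReal NNReal

namespace OTAmbiguity

/-- The couplings of `P` and `Q`: the joint probability distributions on `X × X`
whose first marginal is `P` and whose second marginal is `Q`. -/
def couplings {X : Type*} [MeasurableSpace X] (P Q : ProbabilityMeasure X) :
    Set (ProbabilityMeasure (X × X)) :=
  {π | (π : Measure (X × X)).map Prod.fst = (P : Measure X) ∧
    (π : Measure (X × X)).map Prod.snd = (Q : Measure X)}

/-- The optimal transport discrepancy: the infimum over all couplings of the expected
transportation cost. -/
noncomputable def otDiscrepancy {X : Type*} [MeasurableSpace X] (c : X → X → ℝ≥0∞)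
    (P Q : ProbabilityMeasure X) : ℝ≥0∞ :=
  ⨅ π ∈ couplings P Q, ∫⁻ x, c x.1 x.2 ∂(π : Measure (X × X))

/-- The optimal transport ambiguity set of radius `ε` around `P`. -/
def ambiguitySet {X : Type*} [MeasurableSpace X] (c : X → X → ℝ≥0∞)
    (P : ProbabilityMeasure X) (ε : ℝ) : Set (ProbabilityMeasure X) :=
  {Q | otDiscrepancy c Q P ≤ ENNReal.ofReal ε}

/-- A transportation cost function: a `[0, ∞]`-valued function that satisfies the identity of
indiscernibles. -/
def IsTransportCost {X : Type*} (c : X → X → ℝ≥0∞) : Prop :=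
  ∀ z z', c z z' = 0 ↔ z = z'

/-- `d` is a metric on the set `X`. No relation to a topology on `X` is imposed. -/
structure IsMetric {X : Type*} (d : X → X → ℝ) : Prop where
  nonneg : ∀ x y, 0 ≤ d x y
  eq_zero_iff : ∀ x y, d x y = 0 ↔ x = y
  symm : ∀ x y, d x y = d y x
  triangle : ∀ x y z, d x z ≤ d x y + d y z

/-- The sublevel sets of `d(·, z₀)`, that is, the closed balls of the metric `d`, are compact in
the given topology of `X`. -/
def HasCompactSublevelSets {X : Type*} [TopologicalSpace X] (d : X → X → ℝ) : Prop :=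
  ∀ (z₀ : X) (r : ℝ), IsCompact {z | d z z₀ ≤ r}

end OTAmbiguity

open Filter Set Topology TopologicalSpace

namespace OTAmbiguity

section LowerSemicontinuity

variable {Ω : Type*} [MeasurableSpace Ω] [TopologicalSpace Ω] [OpensMeasurableSpace Ω]

/-! A measure lies in the ambiguity set exactly when, for every slack 1/(m+1), it is the first
marginal of a plan with second marginal `P` and cost at most ε plus the slack; so no optimal plan is
needed. Such plans form a closed set, because expected cost is weakly lower semicontinuous, and a
tight set, because Markov's inequality keeps most mass near the tight measure `P`. By Prokhorov they
form a compact set. The marginal map is continuous, so the ambiguity set is an intersection of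
compact sets in a Hausdorff space. -/

/-- If the measures `μs i` are asymptotically at least as large as `μ` on every open set, then so
are the integrals of every lower semicontinuous function with values in `[0, ∞]`. -/
theorem lintegral_le_liminf_of_lowerSemicontinuous {μ : Measure Ω} {μs : ℕ → Measure Ω}
    {f : Ω → ℝ≥0∞} (hf : LowerSemicontinuous f)
    (h_opens : ∀ G, IsOpen G → μ G ≤ atTop.liminf (fun i ↦ μs i G)) :
    ∫⁻ x, f x ∂μ ≤ atTop.liminf (fun i ↦ ∫⁻ x, f x ∂(μs i)) := by
  have hfm : Measurable f := hf.measurable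
  -- Truncation makes the integrand finite, so the real-valued layer-cake formula applies; its
  -- superlevel sets are open, and Fatou in the level `t` finishes.
  have truncated (m : ℕ) : ∫⁻ x, min (f x) m ∂μ ≤ atTop.liminf (fun i ↦ ∫⁻ x, f x ∂(μs i)) := by
    set g : Ω → ℝ := fun x ↦ (min (f x) m).toReal with hg
    have hne (x : Ω) : min (f x) (m : ℝ≥0∞) ≠ ∞ :=
      ((min_le_right _ _).trans_lt (ENNReal.natCast_lt_top m)).ne
    have hgf (x : Ω) : ENNReal.ofReal (g x) = min (f x) m := ENNReal.ofReal_toReal (hne x)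
    have hg0 : 0 ≤ g := fun x ↦ ENNReal.toReal_nonneg
    have hgm : Measurable g := (hfm.min measurable_const).ennreal_toReal
    have hopen (t : ℝ) (ht : 0 < t) : IsOpen {x | t < g x} := by
      have : {x | t < g x} = {x | ENNReal.ofReal t < f x} ∩ {_x | ENNReal.ofReal t < m} := by
        ext x
        simp only [mem_ofPred_eq, mem_inter_iff, hg]
        rw [← ENNReal.ofReal_lt_iff_lt_toReal ht.le (hne x), lt_min_iff]
      rw [this]
      exact (hf.isOpen_preimage _).inter isOpen_const
    have layer (ν : Measure Ω) :
        ∫⁻ x, min (f x) m ∂ν = ∫⁻ t in Ioi (0 : ℝ), ν {x | t < g x} := by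
      simp_rw [← hgf]
      exact lintegral_eq_lintegral_meas_lt ν (Eventually.of_forall hg0) hgm.aemeasurable
    calc ∫⁻ x, min (f x) m ∂μ
        = ∫⁻ t in Ioi (0 : ℝ), μ {x | t < g x} := layer μ
      _ ≤ ∫⁻ t in Ioi (0 : ℝ), atTop.liminf (fun i ↦ μs i {x | t < g x}) :=
          setLIntegral_mono' measurableSet_Ioi fun t ht ↦ h_opens _ (hopen t ht)
      _ ≤ atTop.liminf (fun i ↦ ∫⁻ t in Ioi (0 : ℝ), μs i {x | t < g x}) :=
          lintegral_liminf_le fun i ↦ Antitone.measurable fun s t hst ↦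
            measure_mono fun x hx ↦ lt_of_le_of_lt hst hx
      _ ≤ atTop.liminf (fun i ↦ ∫⁻ x, f x ∂(μs i)) := by
          refine liminf_le_liminf (Eventually.of_forall fun i ↦ ?_)
          rw [← layer]
          exact lintegral_mono fun x ↦ min_le_left _ _
  have hsup (x : Ω) : f x = ⨆ m : ℕ, min (f x) m := by
    have h : (⨆ m : ℕ, f x ⊓ (m : ℝ≥0∞)) = f x := by
      rw [← inf_iSup_eq, ENNReal.iSup_natCast, inf_top_eq]
    exact h.symm
  calc ∫⁻ x, f x ∂μ = ∫⁻ x, ⨆ m : ℕ, min (f x) m ∂μ := lintegral_congr hsup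
    _ = ⨆ m : ℕ, ∫⁻ x, min (f x) m ∂μ :=
        lintegral_iSup (fun m ↦ hfm.min measurable_const)
          fun a b hab x ↦ min_le_min_left _ (by exact_mod_cast hab)
    _ ≤ _ := iSup_le truncated

end LowerSemicontinuity

section Compactness

variable {X : Type*} [TopologicalSpace X] [MetrizableSpace X] [SecondCountableTopology X]
  [MeasurableSpace X] [BorelSpace X]

/-- The expectation of a lower semicontinuous function is weakly lower semicontinuous: its
sublevel sets are closed. -/
theorem isClosed_setOf_lintegral_le {f : X → ℝ≥0∞} (hf : LowerSemicontinuous f) (r : ℝ≥0∞) :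
    IsClosed {π : ProbabilityMeasure X | ∫⁻ x, f x ∂(π : Measure X) ≤ r} := by
  -- Sequences suffice because the weak topology is metrizable here; the Fatou argument needs them.
  rw [← isSeqClosed_iff_isClosed]
  intro πs π hπs hlim
  calc ∫⁻ x, f x ∂(π : Measure X)
      ≤ atTop.liminf (fun i ↦ ∫⁻ x, f x ∂(πs i : Measure X)) :=
        lintegral_le_liminf_of_lowerSemicontinuous hf fun G hG ↦
          ProbabilityMeasure.le_liminf_measure_open_of_tendsto hlim hG
    _ ≤ atTop.liminf (fun _ : ℕ ↦ r) := liminf_le_liminf (Eventually.of_forall hπs)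
    _ = r := liminf_const r

/-- The probability measures on `X × X` whose second marginal is `P` and whose expected
transportation cost is at most `r`. -/
def boundedCostPlans (c : X → X → ℝ≥0∞) (P : ProbabilityMeasure X) (r : ℝ≥0∞) :
    Set (ProbabilityMeasure (X × X)) :=
  {π | π.map measurable_snd.aemeasurable = P} ∩
    {π | ∫⁻ x, c x.1 x.2 ∂(π : Measure (X × X)) ≤ r}

theorem isClosed_boundedCostPlans {c : X → X → ℝ≥0∞}
    (hlsc : LowerSemicontinuous (fun x : X × X ↦ c x.1 x.2)) (P : ProbabilityMeasure X)
    (r : ℝ≥0∞) : IsClosed (boundedCostPlans c P r) :=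
  (isClosed_singleton.preimage (ProbabilityMeasure.continuous_map continuous_snd)).inter
    (isClosed_setOf_lintegral_le hlsc r)

/-- A probability measure gives small mass to the complements of large balls. -/
theorem tendsto_measure_compl_sublevel {d : X → X → ℝ} (hd : HasCompactSublevelSets d)
    (P : Measure X) [IsFiniteMeasure P] (z₀ : X) :
    Tendsto (fun k : ℕ ↦ P {z | d z z₀ ≤ k}ᶜ) atTop (𝓝 0) := by
  have h := tendsto_measure_iInter_atTop (μ := P) (s := fun k : ℕ ↦ {z | d z z₀ ≤ k}ᶜ)
    (fun k ↦ (hd z₀ k).isClosed.measurableSet.compl.nullMeasurableSet)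
    (fun a b hab ↦ compl_subset_compl.2 fun z (hz : d z z₀ ≤ a) ↦
      hz.trans (by exact_mod_cast hab)) ⟨0, measure_ne_top _ _⟩
  have hempty : (⋂ k : ℕ, {z | d z z₀ ≤ k}ᶜ) = ∅ := by
    refine eq_empty_iff_forall_notMem.2 fun z hz ↦ ?_
    obtain ⟨k, hk⟩ := exists_nat_ge (d z z₀)
    exact mem_iInter.1 hz k hk
  rwa [hempty, measure_empty] at h

/-- If the cost dominates a power of a metric with compact balls, then the plans of bounded cost
with a given second marginal form a tight set. -/
theorem isTightMeasureSet_boundedCostPlans {c : X → X → ℝ≥0∞}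
    (hlsc : LowerSemicontinuous (fun x : X × X ↦ c x.1 x.2)) (P : ProbabilityMeasure X)
    {d : X → X → ℝ} (hd : IsMetric d) (hcpt : HasCompactSublevelSets d) {p : ℕ} (hp : 1 ≤ p)
    (hlb : ∀ z z' : X, ENNReal.ofReal (d z z' ^ p) ≤ c z z') {r : ℝ≥0∞} (hr : r ≠ ∞) :
    IsTightMeasureSet {((π : ProbabilityMeasure (X × X)) : Measure (X × X)) |
      π ∈ boundedCostPlans c P r} := by
  obtain ⟨z₀⟩ := P.nonempty
  have hlim : Tendsto (fun k : ℕ ↦ r / k + (P : Measure X) {z | d z z₀ ≤ k}ᶜ) atTop (𝓝 0) := by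
    have h : Tendsto (fun k : ℕ ↦ r / (k : ℝ≥0∞)) atTop (𝓝 0) := by
      have := ENNReal.Tendsto.const_mul (a := r) ENNReal.tendsto_inv_nat_nhds_zero (Or.inr hr)
      simpa only [mul_zero, ← div_eq_mul_inv] using this
    simpa using h.add (tendsto_measure_compl_sublevel hcpt (P : Measure X) z₀)
  rw [isTightMeasureSet_iff_exists_isCompact_measure_compl_le]
  intro η hη
  -- The bound `1 ≤ k` gives `d ≤ d ^ p` once `k ≤ d`, and permits division by `k` in Markov's
  -- inequality.
  obtain ⟨k, hk, hk1⟩ := ((hlim.eventually_le_const hη).and (eventually_ge_atTop 1)).exists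
  have hk1' : (1 : ℝ) ≤ k := by exact_mod_cast hk1
  -- Radii `2 * k` and `k` force a pair with only its first point outside to be more than `k` apart,
  -- hence to cost at least `k`.
  refine ⟨{z | d z z₀ ≤ 2 * k} ×ˢ {z | d z z₀ ≤ k}, (hcpt z₀ _).prod (hcpt z₀ _), ?_⟩
  rintro _ ⟨π, ⟨hπP, hπc⟩, rfl⟩
  have hsub : ({z | d z z₀ ≤ 2 * k} ×ˢ {z | d z z₀ ≤ k} : Set (X × X))ᶜ ⊆
      {x | (k : ℝ≥0∞) ≤ c x.1 x.2} ∪ Prod.snd ⁻¹' {z | d z z₀ ≤ k}ᶜ := by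
    rintro ⟨z, z'⟩ hx
    by_cases hz' : d z' z₀ ≤ k
    · left
      have hz : 2 * (k : ℝ) < d z z₀ := by
        by_contra h
        exact hx ⟨not_lt.1 h, hz'⟩
      have hdk : (k : ℝ) ≤ d z z' := by linarith [hd.triangle z z' z₀]
      calc (k : ℝ≥0∞) = ENNReal.ofReal k := (ENNReal.ofReal_natCast k).symm
        _ ≤ ENNReal.ofReal (d z z' ^ p) := ENNReal.ofReal_le_ofReal
            (hdk.trans (le_self_pow₀ (hk1'.trans hdk) (by omega)))
        _ ≤ c z z' := hlb z z'
    · exact Or.inr hz'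
  have hmarkov : (π : Measure (X × X)) {x | (k : ℝ≥0∞) ≤ c x.1 x.2} ≤ r / k :=
    (meas_ge_le_lintegral_div hlsc.measurable.aemeasurable
      (by exact_mod_cast (by omega : k ≠ 0)) (ENNReal.natCast_ne_top k)).trans
      (ENNReal.div_le_div_right hπc _)
  have hsnd : (π : Measure (X × X)) (Prod.snd ⁻¹' {z | d z z₀ ≤ k}ᶜ) =
      (P : Measure X) {z | d z z₀ ≤ k}ᶜ := by
    have hP : π.map measurable_snd.aemeasurable = P := hπP
    rw [← hP, ProbabilityMeasure.toMeasure_map,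
      Measure.map_apply measurable_snd (hcpt z₀ _).isClosed.measurableSet.compl]
  calc (π : Measure (X × X)) ({z | d z z₀ ≤ 2 * k} ×ˢ {z | d z z₀ ≤ k})ᶜ
      ≤ (π : Measure (X × X)) {x | (k : ℝ≥0∞) ≤ c x.1 x.2} +
        (π : Measure (X × X)) (Prod.snd ⁻¹' {z | d z z₀ ≤ k}ᶜ) :=
        (measure_mono hsub).trans (measure_union_le _ _)
    _ ≤ r / k + (P : Measure X) {z | d z z₀ ≤ k}ᶜ := add_le_add hmarkov hsnd.le
    _ ≤ η := hk

/-- Prokhorov's theorem makes the closure of a tight set compact, and this set is already closed. -/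
theorem isCompact_boundedCostPlans {c : X → X → ℝ≥0∞}
    (hlsc : LowerSemicontinuous (fun x : X × X ↦ c x.1 x.2)) (P : ProbabilityMeasure X)
    {d : X → X → ℝ} (hd : IsMetric d) (hcpt : HasCompactSublevelSets d) {p : ℕ} (hp : 1 ≤ p)
    (hlb : ∀ z z' : X, ENNReal.ofReal (d z z' ^ p) ≤ c z z') {r : ℝ≥0∞} (hr : r ≠ ∞) :
    IsCompact (boundedCostPlans c P r) := by
  rw [← (isClosed_boundedCostPlans hlsc P r).closure_eq]
  exact isCompact_closure_of_isTightMeasureSet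
    (isTightMeasureSet_boundedCostPlans hlsc P hd hcpt hp hlb hr)

/-- The ambiguity set consists of the measures that are first marginals of plans whose cost exceeds
the radius by arbitrarily little. -/
theorem ambiguitySet_eq_iInter_image (c : X → X → ℝ≥0∞) (P : ProbabilityMeasure X) (ε : ℝ) :
    ambiguitySet c P ε = ⋂ m : ℕ,
      (fun π : ProbabilityMeasure (X × X) ↦ π.map measurable_fst.aemeasurable) ''
        boundedCostPlans c P (ENNReal.ofReal ε + ((m : ℝ≥0∞) + 1)⁻¹) := by
  ext Q
  simp only [mem_iInter]
  constructor
  · intro hQ m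
    -- Positive slack makes the bound strict, so some plan beats it even if the infimum is not
    -- attained.
    have hlt : otDiscrepancy c Q P < ENNReal.ofReal ε + ((m : ℝ≥0∞) + 1)⁻¹ :=
      lt_of_le_of_lt hQ (ENNReal.lt_add_right ENNReal.ofReal_ne_top (by simp))
    simp only [otDiscrepancy, iInf_lt_iff] at hlt
    obtain ⟨π, ⟨hfst, hsnd⟩, hπ⟩ := hlt
    exact ⟨π, ⟨Subtype.ext hsnd, hπ.le⟩, Subtype.ext hfst⟩
  · intro hQ
    have hlim : Tendsto (fun m : ℕ ↦ ENNReal.ofReal ε + ((m : ℝ≥0∞) + 1)⁻¹) atTop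
        (𝓝 (ENNReal.ofReal ε)) := by
      have h := (tendsto_add_atTop_iff_nat 1).2 ENNReal.tendsto_inv_nat_nhds_zero
      simpa using tendsto_const_nhds.add h
    refine ge_of_tendsto' hlim fun m ↦ ?_
    obtain ⟨π, ⟨hsnd, hπ⟩, hfst⟩ := hQ m
    exact (iInf₂_le π ⟨congrArg Subtype.val hfst, congrArg Subtype.val hsnd⟩).trans hπ

/-- Weak compactness of optimal transport ambiguity sets on a separable metrizable space. -/
theorem isCompact_ambiguitySet {c : X → X → ℝ≥0∞}
    (hlsc : LowerSemicontinuous (fun x : X × X ↦ c x.1 x.2)) (P : ProbabilityMeasure X)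
    {d : X → X → ℝ} (hd : IsMetric d) (hcpt : HasCompactSublevelSets d) {p : ℕ} (hp : 1 ≤ p)
    (hlb : ∀ z z' : X, ENNReal.ofReal (d z z' ^ p) ≤ c z z') (ε : ℝ) :
    IsCompact (ambiguitySet c P ε) := by
  rw [ambiguitySet_eq_iInter_image]
  have h (m : ℕ) := (isCompact_boundedCostPlans hlsc P hd hcpt hp hlb
    (r := ENNReal.ofReal ε + ((m : ℝ≥0∞) + 1)⁻¹) (by simp)).image
    (ProbabilityMeasure.continuous_map (continuous_fst (X := X) (Y := X)))
  exact (h 0).of_isClosed_subset (isClosed_iInter fun m ↦ (h m).isClosed) (iInter_subset _ 0)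

end Compactness

end OTAmbiguity

theorem lemma2p3 (n : ℕ) (Z : Set (EuclideanSpace ℝ (Fin n)))
    (hZne : Z.Nonempty) (hZ : IsClosed Z)
    (c : Z → Z → ℝ≥0∞) (hc : OTAmbiguity.IsTransportCost c)
    (hlsc : LowerSemicontinuous (fun x : Z × Z => c x.1 x.2))
    (P : ProbabilityMeasure Z)
    (hint : ∃ z₀ : Z, ∃ C : ℝ≥0, ∫⁻ z, c z z₀ ∂(P : Measure Z) ≤ C)
    (hlb : ∃ d : Z → Z → ℝ, OTAmbiguity.IsMetric d ∧ OTAmbiguity.HasCompactSublevelSets d ∧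
      ∃ p : ℕ, 1 ≤ p ∧ ∀ z z' : Z, ENNReal.ofReal (d z z' ^ p) ≤ c z z')
    (ε : ℝ) (hε : 0 ≤ ε) :
    IsCompact (OTAmbiguity.ambiguitySet c P ε) := by

  obtain ⟨d, hd, hcpt, p, hp, hlb⟩ := hlb
  exact OTAmbiguity.isCompact_ambiguitySet hlsc P hd hcpt hp hlb ε
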